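/- There is a function $\varepsilon:\mathbb{N}\to\mathbb{R}$ with $\varepsilon(\delta)\to 0$ as $\delta\to\infty$ such that, for every integer $\delta\ge 3$ and every finite simple connected graph $G$ with $n$ vertices and minimum degree $\delta$, $$rx_3(G)\;\le\; n\,\frac{\ln(\delta+1)}{\delta+1}\,\bigl(1+\varepsilon(\delta)\bigr)+5 .$$ Here $rx_3(G)$, the 3-rainbow index of $G$, is the least number of colors in an edge-coloring of $G$ (adjacent edges may receive the same color) such that every set of three vertices of $G$ is contained in a tree that is a subgraph of $G$ and no two of whose edges have the same color. -/

import Mathlib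

open Filter Topology

universe u

namespace SimpleGraph

/-- A subgraph `T` of an edge-coloured graph is rainbow if no two of its edges share a colour. -/
def Subgraph.IsRainbow {V : Type*} {G : SimpleGraph V} {K : Type*} (T : G.Subgraph)
    (c : G.EdgeLabeling K) : Prop :=
  ∀ e₁ e₂ : G.edgeSet, (e₁ : Sym2 V) ∈ T.edgeSet → (e₂ : Sym2 V) ∈ T.edgeSet →
    c e₁ = c e₂ → e₁ = e₂

/-- An edge-colouring (not necessarily proper) of `G` is a `k`-rainbow colouring if for every
set `S` of exactly `k` vertices there is a rainbow tree in `G` containing all of `S`. -/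
def IsRainbowColoring {V : Type*} (G : SimpleGraph V) (k : ℕ) {K : Type*}
    (c : G.EdgeLabeling K) : Prop :=
  ∀ S : Finset V, S.card = k →
    ∃ T : G.Subgraph, T.coe.IsTree ∧ (S : Set V) ⊆ T.verts ∧ T.IsRainbow c

/-- The `k`-rainbow index `rx_k(G)`: the least number of colours in a `k`-rainbow colouring. -/
noncomputable def rainbowIndex {V : Type*} (G : SimpleGraph V) (k : ℕ) : ℕ :=
  sInf {t : ℕ | ∃ c : G.EdgeLabeling (Fin t), G.IsRainbowColoring k c}

/-- For a finite connected graph the minimum is over a nonempty set, hence it is attained. -/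
theorem exists_isRainbowColoring_rainbowIndex {V : Type*} [Finite V] {G : SimpleGraph V}
    (hG : G.Connected) (k : ℕ) :
    ∃ c : G.EdgeLabeling (Fin (G.rainbowIndex k)), G.IsRainbowColoring k c := by
  refine Nat.sInf_mem (s := {t : ℕ | ∃ c : G.EdgeLabeling (Fin t), G.IsRainbowColoring k c}) ?_
  obtain ⟨T, hTG, hT⟩ := hG.exists_isTree_le
  refine ⟨Nat.card G.edgeSet, fun e => Finite.equivFin G.edgeSet e, fun S _ => ?_⟩
  refine ⟨SimpleGraph.toSubgraph T hTG, ?_, fun _ _ => Set.mem_univ _, fun e₁ e₂ _ _ h =>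
    (Finite.equivFin G.edgeSet).injective h⟩
  exact (Iso.isTree_iff (G := T) (G' := (toSubgraph T hTG).coe)
    { toEquiv := (Equiv.Set.univ V).symm, map_rel_iff' := Iff.rfl }).1 hT

end SimpleGraph

/-! Suppose `D` induces a connected subgraph and every outer vertex has `k` neighbours in `D`. Give
a spanning tree of `D` distinct colours and `k` edges from each outer vertex into `D` the same `k`
new colours. If the `i`-th of `k` given vertices lies outside `D`, it joins the tree by its edge of
colour `i`, so `rx_k ≤ |D| + k - 1`.

To find a small `D`, write `d = δ + 1` and take a small constant `a`. Greedy growth yields a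
connected `Q` with `O(n / (a d))` vertices such that every vertex has almost all its neighbours in
`W = N[Q]`. A random subset `X` of `W` of density `p ≈ (1 + η/2) ln d / d` stays connected once
joined to `Q`. By an exponential moment bound, about `n / (a^k d)` vertices at most see fewer than
`k` elements of `X`, and each is repaired with `k` neighbours from `W`. Only `X` costs order `n ln d
/ d`; the rest is absorbed by `η/2` for large `δ`. An almost minimal error for each `δ` then gives
`ε`. -/

namespace SimpleGraph

/-! ### Rainbow trees from connected dominating sets -/

/-- A connected subgraph contains a tree on the same vertices. -/
theorem Subgraph.Connected.exists_isTree_le {V : Type*} {G : SimpleGraph V} {H : G.Subgraph}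
    (hH : H.Connected) : ∃ T ≤ H, T.verts = H.verts ∧ T.coe.IsTree := by
  obtain ⟨F, hF, hFt⟩ := hH.coe.exists_isTree_le
  let T : G.Subgraph :=
    { verts := H.verts
      Adj := fun a b => ∃ (ha : a ∈ H.verts) (hb : b ∈ H.verts), F.Adj ⟨a, ha⟩ ⟨b, hb⟩
      adj_sub := fun ⟨_, _, h⟩ => H.adj_sub (hF h)
      edge_vert := fun ⟨ha, _, _⟩ => ha
      symm := ⟨fun _ _ ⟨ha, hb, h⟩ => ⟨hb, ha, h.symm⟩⟩ }
  have hTF : T.coe = F := by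
    ext a b
    exact ⟨fun ⟨_, _, h⟩ => h, fun h => ⟨a.2, b.2, h⟩⟩
  refine ⟨T, ⟨le_rfl, fun _ _ ⟨_, _, h⟩ => hF h⟩, rfl, ?_⟩
  rw [hTF]
  exact hFt

theorem Subgraph.IsRainbow.mono {V : Type*} {G : SimpleGraph V} {K : Type*} {T H : G.Subgraph}
    {c : G.EdgeLabeling K} (hH : H.IsRainbow c) (hTH : T ≤ H) : T.IsRainbow c :=
  fun e₁ e₂ h₁ h₂ h =>
    hH e₁ e₂ (Subgraph.edgeSet_mono hTH h₁) (Subgraph.edgeSet_mono hTH h₂) h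

/-- Rainbow trees may be replaced by rainbow connected subgraphs, and the colours may come from
any finite type. -/
theorem rainbowIndex_le_card {V : Type*} {G : SimpleGraph V} {k : ℕ} {K : Type*} [Finite K]
    (c : G.EdgeLabeling K)
    (hc : ∀ S : Finset V, S.card = k →
      ∃ H : G.Subgraph, H.Connected ∧ (S : Set V) ⊆ H.verts ∧ H.IsRainbow c) :
    G.rainbowIndex k ≤ Nat.card K := by
  refine Nat.sInf_le ⟨fun e => Finite.equivFin K (c e), fun S hS => ?_⟩
  obtain ⟨H, hH, hSH, hr⟩ := hc S hS
  obtain ⟨T, hTH, hv, hT⟩ := hH.exists_isTree_le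
  exact ⟨T, hT, hv ▸ hSH, fun e₁ e₂ h₁ h₂ h =>
    hr.mono hTH e₁ e₂ h₁ h₂ ((Finite.equivFin K).injective h)⟩

theorem Subgraph.card_edgeSet_add_one_of_isTree {V : Type*} [Finite V] {G : SimpleGraph V}
    {T : G.Subgraph} (hT : T.coe.IsTree) : Nat.card T.edgeSet + 1 = Nat.card T.verts := by
  rw [← (isTree_iff_connected_and_card.1 hT).2, ← T.image_coe_edgeSet_coe,
    Nat.card_image_of_injective (Sym2.map.injective Subtype.val_injective)]

/-- A connected subgraph can be enlarged by pendant edges. -/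
theorem Subgraph.Connected.exists_attach {V ι : Type*} {G : SimpleGraph V} {T : G.Subgraph}
    (hT : T.Connected) (x y : ι → V) (hy : ∀ i, y i ∈ T.verts)
    (hxy : ∀ i, x i ∉ T.verts → G.Adj (x i) (y i)) (s : Finset ι) :
    ∃ H : G.Subgraph, H.Connected ∧ T ≤ H ∧ (∀ i ∈ s, x i ∈ H.verts) ∧
      ∀ e ∈ H.edgeSet, e ∈ T.edgeSet ∨ ∃ i, x i ∉ T.verts ∧ e = s(x i, y i) := by
  classical
  induction s using Finset.induction_on with
  | empty => exact ⟨T, hT, le_rfl, by simp, fun e he => Or.inl he⟩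
  | insert i s _ ih =>
    obtain ⟨H, hH, hTH, hs, he⟩ := ih
    by_cases hi : x i ∈ T.verts
    · refine ⟨H, hH, hTH, ?_, he⟩
      intro j hj
      rcases Finset.mem_insert.1 hj with rfl | hj
      · exact hTH.1 hi
      · exact hs j hj
    · refine ⟨H ⊔ G.subgraphOfAdj (hxy i hi), ?_, hTH.trans le_sup_left, ?_, ?_⟩
      · exact Subgraph.connected_sup hH.preconnected
          (subgraphOfAdj_connected _).preconnected ⟨y i, hTH.1 (hy i), by simp⟩
      · intro j hj
        rcases Finset.mem_insert.1 hj with rfl | hj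
        · exact Or.inr (by simp)
        · exact Or.inl (hs j hj)
      · intro e h
        rw [Subgraph.edgeSet_sup, edgeSet_subgraphOfAdj] at h
        rcases h with h | h
        · exact he e h
        · exact Or.inr ⟨i, hi, h⟩

/-- Connected `k`-dominating sets bound the `k`-rainbow index: colour a spanning tree of `D` with
distinct colours and `k` edges from each outer vertex to `D` with `k` further colours. -/
theorem rainbowIndex_le_of_connected_dominating {V : Type*} [Finite V] {G : SimpleGraph V}
    {k : ℕ} (hk : 0 < k) (D : Finset V) (hD : (G.induce (D : Set V)).Connected)
    (hdom : ∀ v ∉ D, ∃ A : Finset V, A ⊆ D ∧ (∀ w ∈ A, G.Adj v w) ∧ k ≤ A.card) :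
    G.rainbowIndex k + 1 ≤ D.card + k := by
  classical
  obtain ⟨T, -, hTv, hT⟩ := (connected_induce_iff.1 hD).exists_isTree_le
  replace hTv : T.verts = D := hTv
  have hTc : T.Connected := ⟨hT.connected⟩
  have hg : ∀ v, ∃ g : Fin k → V, v ∉ D →
      Function.Injective g ∧ ∀ i, g i ∈ D ∧ G.Adj v (g i) := by
    intro v
    by_cases hv : v ∈ D
    · exact ⟨fun _ => v, fun h => absurd hv h⟩
    · obtain ⟨A, hAD, hA, hcard⟩ := hdom v hv
      obtain ⟨f⟩ : Nonempty (Fin k ↪ A) :=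
        Function.Embedding.nonempty_of_card_le (by simpa using hcard)
      exact ⟨fun i => f i, fun _ => ⟨Subtype.val_injective.comp f.injective,
        fun i => ⟨hAD (f i).2, hA _ (f i).2⟩⟩⟩
  choose g hg using hg
  have huniq : ∀ v w i j, v ∉ D → w ∉ D → s(v, g v i) = s(w, g w j) → v = w ∧ i = j := by
    intro v w i j hv hw h
    rcases Sym2.eq_iff.1 h with ⟨rfl, h⟩ | ⟨rfl, -⟩
    · exact ⟨rfl, (hg v hv).1 h⟩
    · exact absurd ((hg w hw).2 j).1 hv
  let c : G.EdgeLabeling (T.edgeSet ⊕ Fin k) := fun e =>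
    if h : (e : Sym2 V) ∈ T.edgeSet then Sum.inl ⟨e, h⟩
    else if h : ∃ p : V × Fin k, p.1 ∉ D ∧ (e : Sym2 V) = s(p.1, g p.1 p.2) then
      Sum.inr h.choose.2
    -- The remaining edges occur in no tree that is built, so their colour is arbitrary.
    else Sum.inr ⟨0, hk⟩
  have hcT : ∀ (e : G.edgeSet) (h : (e : Sym2 V) ∈ T.edgeSet), c e = Sum.inl ⟨e, h⟩ :=
    fun e h => dif_pos h
  have hcD : ∀ (e : G.edgeSet) (v : V) (i : Fin k), v ∉ D → (e : Sym2 V) = s(v, g v i) →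
      c e = Sum.inr i := by
    intro e v i hv he
    have h₁ : (e : Sym2 V) ∉ T.edgeSet := fun h => by
      rw [he] at h
      have := T.edge_vert (Subgraph.mem_edgeSet.1 h)
      rw [hTv] at this
      exact hv this
    have h₂ : ∃ p : V × Fin k, p.1 ∉ D ∧ (e : Sym2 V) = s(p.1, g p.1 p.2) := ⟨(v, i), hv, he⟩
    have h₃ : c e = Sum.inr h₂.choose.2 := (dif_neg h₁).trans (dif_pos h₂)
    rw [h₃, (huniq v h₂.choose.1 i h₂.choose.2 hv h₂.choose_spec.1
      (he.symm.trans h₂.choose_spec.2)).2]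
  have key : G.rainbowIndex k ≤ Nat.card (T.edgeSet ⊕ Fin k) := by
    refine rainbowIndex_le_card c fun S hS => ?_
    -- Numbering `S` assigns the new colours: distinct outer vertices attach by edges of distinct
    -- colours.
    have e : Fin k ≃ S := (Fintype.equivFinOfCardEq (by simpa using hS)).symm
    have hx : ∀ i, ((e i : S) : V) ∉ T.verts → ((e i : S) : V) ∉ D := fun i h => by
      rw [hTv] at h
      exact h
    obtain ⟨d, hd⟩ := hTc.nonempty
    let y : Fin k → V := fun i => if ((e i : S) : V) ∈ D then d else g (e i) i
    have hyD : ∀ i, ((e i : S) : V) ∉ D → y i = g (e i) i := fun i h => if_neg h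
    obtain ⟨H, hH, -, hs, he⟩ := hTc.exists_attach (fun i => ((e i : S) : V)) y
      (fun i => by
        by_cases h : ((e i : S) : V) ∈ D
        · rw [show y i = d from if_pos h]
          exact hd
        · rw [hyD i h, hTv]
          exact ((hg _ h).2 i).1)
      (fun i hi => by
        rw [hyD i (hx i hi)]
        exact ((hg _ (hx i hi)).2 i).2) Finset.univ
    refine ⟨H, hH, fun v hv => ?_, ?_⟩
    · simpa using hs (e.symm ⟨v, hv⟩) (Finset.mem_univ _)
    · intro e₁ e₂ h₁ h₂ h
      rcases he _ h₁ with h₁ | ⟨i, hi, h₁⟩ <;> rcases he _ h₂ with h₂ | ⟨j, hj, h₂⟩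
      · rw [hcT _ h₁, hcT _ h₂] at h
        exact Subtype.ext (Subtype.mk.inj (Sum.inl.inj h))
      · rw [hyD j (hx j hj)] at h₂
        rw [hcT _ h₁, hcD _ _ _ (hx j hj) h₂] at h
        cases h
      · rw [hyD i (hx i hi)] at h₁
        rw [hcT _ h₂, hcD _ _ _ (hx i hi) h₁] at h
        cases h
      · have h₁' := h₁
        have h₂' := h₂
        rw [hyD i (hx i hi)] at h₁'
        rw [hyD j (hx j hj)] at h₂'
        rw [hcD _ _ _ (hx i hi) h₁', hcD _ _ _ (hx j hj) h₂'] at h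
        obtain rfl := Sum.inr.inj h
        exact Subtype.ext (h₁.trans h₂.symm)
  have hcard := Subgraph.card_edgeSet_add_one_of_isTree hT
  rw [hTv] at hcard
  rw [Nat.card_sum, Nat.card_fin] at key
  have : Nat.card ((D : Set V) : Type _) = D.card := by simp
  omega

end SimpleGraph

namespace SimpleGraph

/-! ### Growing a connected set that almost covers all neighbourhoods -/

/-- The closed neighbourhood of a set of vertices. -/
def closedNeighborFinset {V : Type*} [Fintype V] [DecidableEq V] (G : SimpleGraph V)
    [DecidableRel G.Adj] (Q : Finset V) : Finset V :=
  Q ∪ Q.biUnion fun v => G.neighborFinset v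

section

variable {V : Type*} [Fintype V] [DecidableEq V] {G : SimpleGraph V} [DecidableRel G.Adj]

theorem mem_closedNeighborFinset {Q : Finset V} {v : V} :
    v ∈ G.closedNeighborFinset Q ↔ v ∈ Q ∨ ∃ q ∈ Q, G.Adj q v := by
  simp [closedNeighborFinset]

theorem subset_closedNeighborFinset (Q : Finset V) : Q ⊆ G.closedNeighborFinset Q :=
  Finset.subset_union_left

theorem closedNeighborFinset_mono {P Q : Finset V} (h : P ⊆ Q) :
    G.closedNeighborFinset P ⊆ G.closedNeighborFinset Q :=
  Finset.union_subset_union h (Finset.biUnion_subset_biUnion_of_subset_left _ h)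

theorem neighborFinset_subset_closedNeighborFinset {Q : Finset V} {v : V} (hv : v ∈ Q) :
    G.neighborFinset v ⊆ G.closedNeighborFinset Q := fun w hw =>
  mem_closedNeighborFinset.2 (Or.inr ⟨v, hv, (G.mem_neighborFinset v w).1 hw⟩)

theorem induce_insert_connected {Q : Finset V} (hQ : (G.induce (Q : Set V)).Connected) {a : V}
    (ha : a ∈ G.closedNeighborFinset Q) : (G.induce (insert a Q : Finset V)).Connected := by
  rcases mem_closedNeighborFinset.1 ha with ha | ⟨q, hq, hqa⟩
  · rwa [Finset.insert_eq_of_mem ha]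
  · have := connected_induce_union hQ.preconnected
      (induce_pair_connected_of_adj hqa.symm).preconnected hq (Set.mem_insert a _) hqa
    have hs : ((insert a Q : Finset V) : Set V) = (Q : Set V) ∪ {a, q} := by
      ext v
      simp only [Finset.coe_insert, Set.mem_insert_iff, Finset.mem_coe, Set.mem_union,
        Set.mem_singleton_iff]
      grind
    rwa [hs]

/-- Each vertex of `X` lies in `Q` or hangs directly from it. Hence the random choice and the
repairs inside `N[Q]` need no connecting vertices. -/
theorem induce_union_connected_of_subset {Q X : Finset V}
    (hQ : (G.induce (Q : Set V)).Connected) (hX : X ⊆ G.closedNeighborFinset Q) :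
    (G.induce (X ∪ Q : Finset V)).Connected := by
  induction X using Finset.induction_on with
  | empty => rwa [Finset.empty_union]
  | insert a X _ ih =>
    rw [Finset.insert_union]
    exact induce_insert_connected (ih fun v hv => hX (Finset.mem_insert_of_mem hv))
      (closedNeighborFinset_mono Finset.subset_union_right (hX (Finset.mem_insert_self a X)))

/-- In a connected graph, a nonempty proper set of vertices has an outer neighbour. -/
theorem Connected.exists_mem_compl_closedNeighborFinset (hG : G.Connected) {P : Finset V}
    (hP : P.Nonempty) (h : ∃ v, v ∉ P) :
    ∃ w, w ∉ P ∧ w ∈ G.closedNeighborFinset P := by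
  obtain ⟨u, hu⟩ := hP
  obtain ⟨v, hv⟩ := h
  obtain ⟨p⟩ := hG.preconnected u v
  obtain ⟨d, -, h₁, h₂⟩ := p.exists_boundary_dart (P : Set V) hu hv
  exact ⟨d.snd, h₂, mem_closedNeighborFinset.2 (Or.inr ⟨d.fst, h₁, d.adj⟩)⟩

theorem exists_mem_closedNeighborFinset_insert {Q : Finset V} {w : V}
    (h : w ∈ G.closedNeighborFinset (G.closedNeighborFinset Q)) :
    ∃ a ∈ G.closedNeighborFinset Q, w ∈ G.closedNeighborFinset (insert a Q) := by
  rcases mem_closedNeighborFinset.1 h with h | ⟨a, ha, haw⟩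
  · exact ⟨w, h, subset_closedNeighborFinset _ (Finset.mem_insert_self _ _)⟩
  · exact ⟨a, ha, mem_closedNeighborFinset.2 (Or.inr ⟨a, Finset.mem_insert_self _ _, haw⟩)⟩

/-- A connected set can be enlarged by at most three vertices so that its closed neighbourhood
grows by `t`, as long as some vertex has `t` neighbours outside the closed neighbourhood. -/
theorem Connected.exists_enlarge (hG : G.Connected) {t : ℕ} (ht : ∀ v, t ≤ G.degree v)
    {Q : Finset V} (hQ : (G.induce (Q : Set V)).Connected) {v : V}
    (hv : t ≤ (G.neighborFinset v \ G.closedNeighborFinset Q).card) :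
    ∃ Q' : Finset V, (G.induce (Q' : Set V)).Connected ∧ Q'.card ≤ Q.card + 3 ∧
      (G.closedNeighborFinset Q).card + t ≤ (G.closedNeighborFinset Q').card := by
  suffices h : ∃ Q' : Finset V, (G.induce (Q' : Set V)).Connected ∧ Q'.card ≤ Q.card + 3 ∧
      Q ⊆ Q' ∧ ∃ w ∈ Q', t ≤ (G.neighborFinset w \ G.closedNeighborFinset Q).card by
    obtain ⟨Q', h₁, h₂, h₃, w, hw, h₄⟩ := h
    refine ⟨Q', h₁, h₂, (Nat.add_le_add_left h₄ _).trans ?_⟩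
    rw [← Finset.card_union_of_disjoint Finset.disjoint_sdiff, Finset.union_sdiff_self_eq_union]
    exact Finset.card_le_card (Finset.union_subset (closedNeighborFinset_mono h₃)
      (neighborFinset_subset_closedNeighborFinset hw))
  obtain ⟨⟨q, hq⟩⟩ := hQ.nonempty
  have hne : (G.closedNeighborFinset (G.closedNeighborFinset Q)).Nonempty :=
    ⟨q, subset_closedNeighborFinset _ (subset_closedNeighborFinset _ hq)⟩
  -- If some vertex is at distance at least 3 from `Q`, one is at distance exactly 3, and none of
  -- its neighbours is covered yet. Otherwise `v` itself is within distance 2.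
  by_cases hall : ∃ w, w ∉ G.closedNeighborFinset (G.closedNeighborFinset Q)
  · obtain ⟨w, hw, hw'⟩ := hG.exists_mem_compl_closedNeighborFinset hne hall
    obtain ⟨b, hb, hwb⟩ := exists_mem_closedNeighborFinset_insert hw'
    obtain ⟨a, ha, hba⟩ := exists_mem_closedNeighborFinset_insert hb
    have hbw : G.Adj b w := by
      rcases mem_closedNeighborFinset.1 hwb with h | ⟨x, hx, hxw⟩
      · rcases Finset.mem_insert.1 h with rfl | h
        · exact absurd hb hw
        · exact absurd (subset_closedNeighborFinset _ h) hw
      · rcases Finset.mem_insert.1 hx with rfl | hx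
        · exact hxw
        · exact absurd (mem_closedNeighborFinset.2 (Or.inr ⟨x, hx, hxw⟩)) hw
    refine ⟨insert w (insert b (insert a Q)), ?_, ?_, ?_, w, Finset.mem_insert_self _ _, ?_⟩
    · exact induce_insert_connected (induce_insert_connected (induce_insert_connected hQ ha) hba)
        (mem_closedNeighborFinset.2 (Or.inr ⟨b, Finset.mem_insert_self _ _, hbw⟩))
    · exact (Finset.card_insert_le _ _).trans (Nat.succ_le_succ
        ((Finset.card_insert_le _ _).trans (Nat.succ_le_succ (Finset.card_insert_le _ _))))
    · exact ((Finset.subset_insert _ _).trans (Finset.subset_insert _ _)).trans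
        (Finset.subset_insert _ _)
    · rw [Finset.sdiff_eq_self_of_disjoint, card_neighborFinset_eq_degree]
      · exact ht w
      · refine Finset.disjoint_left.2 fun x hx hx' => hw (mem_closedNeighborFinset.2 (Or.inr
          ⟨x, hx', ((G.mem_neighborFinset w x).1 hx).symm⟩))
  · push Not at hall
    obtain ⟨a, ha, hva⟩ := exists_mem_closedNeighborFinset_insert (hall v)
    refine ⟨insert v (insert a Q), ?_, ?_, ?_, v, Finset.mem_insert_self _ _, hv⟩
    · exact induce_insert_connected (induce_insert_connected hQ ha) hva
    · exact ((Finset.card_insert_le _ _).trans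
        (Nat.succ_le_succ (Finset.card_insert_le _ _))).trans (Nat.le_succ _)
    · exact (Finset.subset_insert _ _).trans (Finset.subset_insert _ _)

/-- There is a small connected set such that each vertex has few neighbours outside its closed
neighbourhood. -/
theorem Connected.exists_connected_few_uncovered (hG : G.Connected) {t : ℕ} (ht0 : 0 < t)
    (ht : ∀ v, t ≤ G.degree v) :
    ∃ Q : Finset V, (G.induce (Q : Set V)).Connected ∧ t * Q.card ≤ 3 * Fintype.card V ∧
      ∀ v, (G.neighborFinset v \ G.closedNeighborFinset Q).card < t := by
  -- Three added vertices pay for `t` newly covered ones, so an enlargement stays in `F`; maximal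
  -- coverage therefore rules out a further enlargement.
  let F : Finset (Finset V) := {Q | (G.induce (Q : Set V)).Connected ∧
    t * Q.card ≤ 3 * (G.closedNeighborFinset Q).card}
  have hF : F.Nonempty := by
    obtain ⟨v⟩ := hG.nonempty
    refine ⟨{v}, Finset.mem_filter.2 ⟨Finset.mem_univ _, ?_, ?_⟩⟩
    · rw [Finset.coe_singleton]
      exact { preconnected := Preconnected.of_subsingleton, nonempty := ⟨⟨v, rfl⟩⟩ }
    · have h := Finset.card_le_card
        (G.neighborFinset_subset_closedNeighborFinset (Finset.mem_singleton_self v))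
      rw [card_neighborFinset_eq_degree] at h
      have := ht v
      rw [Finset.card_singleton]
      omega
  obtain ⟨Q, hQF, hmax⟩ := F.exists_max_image (fun Q => (G.closedNeighborFinset Q).card) hF
  obtain ⟨-, hQ, hQt⟩ := Finset.mem_filter.1 hQF
  refine ⟨Q, hQ, hQt.trans (Nat.mul_le_mul_left 3 (Finset.card_le_univ _)), fun v => ?_⟩
  by_contra! hv
  obtain ⟨Q', h₁, h₂, h₃⟩ := hG.exists_enlarge ht hQ hv
  have := hmax Q' (Finset.mem_filter.2 ⟨Finset.mem_univ _, h₁, by nlinarith⟩)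
  omega

end

/-! ### Random selection and repair -/

/-- Derandomised selection: including each element of `W` independently with probability `p` has
expected cost given by the right-hand side, so some subset of `W` costs at most that. -/
theorem exists_subset_cost_le {α ι : Type*} [DecidableEq α] {s p : ℝ} (hp0 : 0 ≤ p) (hp1 : p ≤ 1)
    (A : ι → Finset α) (I : Finset ι) (W : Finset α) (c : ι → ℝ) :
    ∃ X ⊆ W, (X.card : ℝ) + ∑ v ∈ I, c v * s ^ (X ∩ A v).card ≤
      p * W.card + ∑ v ∈ I, c v * (1 - p * (1 - s)) ^ (W ∩ A v).card := by
  induction W using Finset.induction_on generalizing c with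
  | empty => exact ⟨∅, le_rfl, by simp⟩
  | insert w W hw ih =>
    set r := 1 - p * (1 - s) with hr
    obtain ⟨X, hXW, hX⟩ := ih c
    -- Conditioning on `w` being chosen multiplies the weight of each `v` with `w ∈ A v` by `s`. The
    -- cheaper of the two cases is at most their average.
    obtain ⟨Y, hYW, hY⟩ := ih fun v => if w ∈ A v then c v * s else c v
    have hYw : w ∉ Y := fun h => hw (hYW h)
    have hins : ∀ Z : Finset α, w ∉ Z → ∀ v (x : ℝ), x ^ (insert w Z ∩ A v).card =
        if w ∈ A v then x * x ^ (Z ∩ A v).card else x ^ (Z ∩ A v).card := by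
      intro Z hZ v x
      split_ifs with h
      · rw [Finset.insert_inter_of_mem h, Finset.card_insert_of_notMem (by simp [hZ]), pow_succ']
      · rw [Finset.insert_inter_of_notMem h]
    have hcost : ((insert w Y).card : ℝ) + ∑ v ∈ I, c v * s ^ (insert w Y ∩ A v).card =
        1 + ((Y.card : ℝ) +
          ∑ v ∈ I, (if w ∈ A v then c v * s else c v) * s ^ (Y ∩ A v).card) := by
      rw [Finset.card_insert_of_notMem hYw, Finset.sum_congr rfl fun v _ => ?_]
      · push_cast
        ring
      · rw [hins Y hYw v s]
        split_ifs <;> ring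
    have havg : p * ((insert w W).card : ℝ) + ∑ v ∈ I, c v * r ^ (insert w W ∩ A v).card =
        p * (1 + (p * W.card +
          ∑ v ∈ I, (if w ∈ A v then c v * s else c v) * r ^ (W ∩ A v).card)) +
        (1 - p) * (p * W.card + ∑ v ∈ I, c v * r ^ (W ∩ A v).card) := by
      have : ∑ v ∈ I, c v * r ^ (insert w W ∩ A v).card =
          p * ∑ v ∈ I, (if w ∈ A v then c v * s else c v) * r ^ (W ∩ A v).card +
          (1 - p) * ∑ v ∈ I, c v * r ^ (W ∩ A v).card := by
        rw [Finset.mul_sum, Finset.mul_sum, ← Finset.sum_add_distrib]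
        refine Finset.sum_congr rfl fun v _ => ?_
        rw [hins W hw v r]
        split_ifs
        · rw [hr]
          ring
        · ring
      rw [this, Finset.card_insert_of_notMem hw]
      push_cast
      ring
    rw [havg]
    by_cases hle : (X.card : ℝ) + ∑ v ∈ I, c v * s ^ (X ∩ A v).card ≤
        1 + ((Y.card : ℝ) + ∑ v ∈ I, (if w ∈ A v then c v * s else c v) * s ^ (Y ∩ A v).card)
    · refine ⟨X, hXW.trans (Finset.subset_insert _ _), ?_⟩
      nlinarith [mul_le_mul_of_nonneg_left (hle.trans (add_le_add_right hY 1)) hp0,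
        mul_le_mul_of_nonneg_left hX (sub_nonneg.2 hp1)]
    · refine ⟨insert w Y, Finset.insert_subset_insert _ hYW, ?_⟩
      rw [hcost]
      nlinarith [mul_le_mul_of_nonneg_left (add_le_add_right hY 1) hp0,
        mul_le_mul_of_nonneg_left ((not_le.1 hle).le.trans hX) (sub_nonneg.2 hp1)]

/-- Connected `k`-dominating sets of nearly optimal size. -/
theorem Connected.exists_connected_dominating {V : Type*} [Fintype V] {G : SimpleGraph V}
    [DecidableRel G.Adj] (hG : G.Connected) {k t m : ℕ} (ht0 : 0 < t) (hkm : k ≤ m)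
    (hdeg : ∀ v, t + m ≤ G.degree v + 1) (ht : ∀ v, t ≤ G.degree v) {s p : ℝ} (hs0 : 0 < s)
    (hs1 : s ≤ 1) (hp0 : 0 ≤ p) (hp1 : p ≤ 1) :
    ∃ D : Finset V, (G.induce (D : Set V)).Connected ∧
      (∀ v ∉ D, ∃ A : Finset V, A ⊆ D ∧ (∀ w ∈ A, G.Adj v w) ∧ k ≤ A.card) ∧
      (D.card : ℝ) ≤ Fintype.card V *
        (3 / t + p + k / s ^ k * (1 - p * (1 - s)) ^ m) := by
  classical
  obtain ⟨Q, hQ, hQt, hQv⟩ := hG.exists_connected_few_uncovered ht0 ht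
  set W := G.closedNeighborFinset Q with hW
  have hm : ∀ v, m ≤ (W ∩ G.neighborFinset v).card := fun v => by
    have h₁ := Finset.card_inter_add_card_sdiff (G.neighborFinset v) W
    rw [Finset.inter_comm, card_neighborFinset_eq_degree] at h₁
    have := hQv v
    have := hdeg v
    omega
  obtain ⟨X, hXW, hX⟩ := exists_subset_cost_le (s := s) hp0 hp1 (fun v => G.neighborFinset v)
    Finset.univ W fun _ => (k : ℝ) / s ^ k
  have hB : ∀ v, ∃ B ⊆ W ∩ G.neighborFinset v, B.card = k := fun v =>
    Finset.exists_subset_card_eq (hkm.trans (hm v))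
  choose B hBW hBk using hB
  let bad : Finset V := {v | (X ∩ G.neighborFinset v).card < k}
  let D := (X ∪ bad.biUnion B) ∪ Q
  refine ⟨D, induce_union_connected_of_subset hQ (Finset.union_subset hXW
    (Finset.biUnion_subset.2 fun v _ => (hBW v).trans Finset.inter_subset_left)), ?_, ?_⟩
  · intro v _
    by_cases hv : v ∈ bad
    · refine ⟨B v, fun w hw => ?_, fun w hw => ?_, (hBk v).ge⟩
      · exact Finset.mem_union_left _ (Finset.mem_union_right _ (Finset.mem_biUnion.2 ⟨v, hv, hw⟩))
      · exact (G.mem_neighborFinset v w).1 (Finset.mem_inter.1 (hBW v hw)).2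
    · refine ⟨X ∩ G.neighborFinset v, fun w hw => ?_, fun w hw => ?_, ?_⟩
      · exact Finset.mem_union_left _ (Finset.mem_union_left _ (Finset.mem_inter.1 hw).1)
      · exact (G.mem_neighborFinset v w).1 (Finset.mem_inter.1 hw).2
      · simpa [bad] using hv
  · have hDc : D.card ≤ X.card + bad.card * k + Q.card := by
      refine (Finset.card_union_le _ _).trans (Nat.add_le_add_right
        ((Finset.card_union_le _ _).trans (Nat.add_le_add_left ?_ _)) _)
      exact Finset.card_biUnion_le_card_mul _ _ _ fun v _ => (hBk v).le
    have hDr : (D.card : ℝ) ≤ X.card + bad.card * k + Q.card := by exact_mod_cast hDc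
    have hQr : (Q.card : ℝ) ≤ Fintype.card V * (3 / t) := by
      have : (t : ℝ) * Q.card ≤ 3 * Fintype.card V := by exact_mod_cast hQt
      rw [← mul_div_assoc, le_div_iff₀ (by exact_mod_cast ht0)]
      linarith
    -- Markov's inequality for `s ^ |X ∩ N(v)|`: a bad vertex contributes at least `k`, since `s ≤
    -- 1`.
    have hbad : (bad.card : ℝ) * k ≤
        ∑ v, (k : ℝ) / s ^ k * s ^ (X ∩ G.neighborFinset v).card := by
      rw [← nsmul_eq_mul, ← Finset.sum_const]
      refine (Finset.sum_le_sum fun v hv => ?_).trans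
        (Finset.sum_le_sum_of_subset_of_nonneg (Finset.subset_univ bad)
          fun v _ _ => by positivity)
      have hv' : (X ∩ G.neighborFinset v).card < k := by simpa [bad] using hv
      rw [div_mul_eq_mul_div, le_div_iff₀ (by positivity)]
      exact mul_le_mul_of_nonneg_left (pow_le_pow_of_le_one hs0.le hs1 hv'.le) (by positivity)
    have hr0 : 0 ≤ 1 - p * (1 - s) := by nlinarith
    have hr1 : 1 - p * (1 - s) ≤ 1 := by nlinarith
    have hsum : ∑ v, (k : ℝ) / s ^ k * (1 - p * (1 - s)) ^ (W ∩ G.neighborFinset v).card ≤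
        Fintype.card V * (k / s ^ k * (1 - p * (1 - s)) ^ m) := by
      refine (Finset.sum_le_card_nsmul Finset.univ _ (k / s ^ k * (1 - p * (1 - s)) ^ m)
        fun v _ => ?_).trans_eq (by rw [nsmul_eq_mul, Finset.card_univ])
      exact mul_le_mul_of_nonneg_left (pow_le_pow_of_le_one hr0 hr1 (hm v)) (by positivity)
    have hWn : p * (W.card : ℝ) ≤ Fintype.card V * p := by
      rw [mul_comm]
      exact mul_le_mul_of_nonneg_right (by exact_mod_cast Finset.card_le_univ W) hp0
    linarith

end SimpleGraph

namespace SimpleGraph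

/-! ### Choice of parameters -/

/-- The bound on the `k`-rainbow index as soon as `δ` is large enough in terms of `η` and `k`. -/
theorem Connected.rainbowIndex_le_of_large_minDegree {V : Type*} [Fintype V] {G : SimpleGraph V}
    [DecidableRel G.Adj] (hG : G.Connected) {k : ℕ} (hk : 0 < k) {δ : ℕ}
    (hδ : ∀ v, δ ≤ G.degree v) {η a d : ℝ} (hη : 0 < η) (ha : a = η / (3 * (η + 2)))
    (hd : d = (δ : ℝ) + 1) (had : 1 ≤ a * d) (hdk : 3 * (k : ℝ) ≤ d)
    (hp : Real.log d * (1 + η / 2) ≤ d) (hlog : 3 / a + k / a ^ k ≤ Real.log d * (η / 2)) :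
    (G.rainbowIndex k : ℝ) ≤ Fintype.card V * (Real.log d / d) * (1 + η) + (k - 1) := by
  have ha0 : 0 < a := by rw [ha]; positivity
  -- This identity dictates `a`: since `(1 - 2a)(1 - a) ≥ 1 - 3a`, the exponent `m p (1 - a)`
  -- reaches `log d`.
  have ha3 : (1 - 3 * a) * (1 + η / 2) = 1 := by
    rw [ha]
    field_simp
    ring
  have ha1 : 3 * a < 1 := by nlinarith
  have hd1 : 1 ≤ d := by
    rw [hd]
    linarith [Nat.cast_nonneg (α := ℝ) δ]
  have hd0 : 0 < d := by linarith
  have hlog0 : 0 ≤ Real.log d := Real.log_nonneg hd1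
  set t := ⌈a * d⌉₊ with ht
  have ht1 : a * d ≤ t := Nat.le_ceil _
  have ht2 : (t : ℝ) ≤ 2 * (a * d) := by
    have := Nat.ceil_lt_add_one (a := a * d) (by positivity)
    linarith
  have htd : t ≤ δ + 1 := by
    have : (t : ℝ) ≤ (δ : ℝ) + 1 := by
      rw [← hd]
      nlinarith
    exact_mod_cast this
  obtain ⟨m, hm⟩ := Nat.exists_eq_add_of_le htd
  have hmd : (1 - 2 * a) * d ≤ m := by
    have : d = t + m := by
      rw [hd]
      exact_mod_cast hm
    nlinarith
  have hkm : k ≤ m := by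
    have : (k : ℝ) ≤ m := by nlinarith
    exact_mod_cast this
  have ht0 : 0 < t := Nat.ceil_pos.2 (by positivity)
  set p := Real.log d * (1 + η / 2) / d with hpdef
  have hp0 : 0 ≤ p := by positivity
  have hp1 : p ≤ 1 := (div_le_one hd0).2 hp
  obtain ⟨D, hD, hdom, hcard⟩ := hG.exists_connected_dominating (k := k) (m := m) ht0 hkm
    (fun v => by have := hδ v; omega) (fun v => by have := hδ v; omega) ha0
    (by linarith) hp0 hp1
  have hexp : (1 - p * (1 - a)) ^ m ≤ 1 / d := by
    have h₁ : 0 ≤ 1 - p * (1 - a) := by nlinarith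
    have h₂ : Real.log d ≤ m * (p * (1 - a)) := by
      have h₃ : p * d * (1 - 3 * a) = Real.log d := by
        rw [hpdef, div_mul_cancel₀ _ hd0.ne', mul_assoc, mul_comm (1 + η / 2), ha3, mul_one]
      have h₄ : 0 ≤ p * (1 - a) := mul_nonneg hp0 (by linarith)
      have h₅ := mul_le_mul_of_nonneg_right hmd h₄
      have h₆ : p * d * (1 - 3 * a) ≤ (1 - 2 * a) * d * (p * (1 - a)) := by
        have : 0 ≤ p * d * (2 * a ^ 2) := by positivity
        linarith
      linarith
    calc (1 - p * (1 - a)) ^ m ≤ Real.exp (-(p * (1 - a))) ^ m :=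
          pow_le_pow_left₀ h₁ (Real.one_sub_le_exp_neg _) m
      _ = Real.exp (-(m * (p * (1 - a)))) := by rw [← Real.exp_nat_mul, mul_neg]
      _ ≤ Real.exp (-Real.log d) := Real.exp_le_exp.2 (neg_le_neg h₂)
      _ = 1 / d := by rw [Real.exp_neg, Real.exp_log hd0, one_div]
  have htot : 3 / t + p + k / a ^ k * (1 - p * (1 - a)) ^ m ≤ Real.log d / d * (1 + η) := by
    have h₁ : 3 / (t : ℝ) ≤ 3 / a / d := by
      rw [div_div]
      exact div_le_div_of_nonneg_left (by norm_num) (by positivity) ht1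
    have h₂ : k / a ^ k * (1 - p * (1 - a)) ^ m ≤ k / a ^ k / d := by
      rw [div_eq_mul_one_div (k / a ^ k) d]
      exact mul_le_mul_of_nonneg_left hexp (by positivity)
    calc 3 / t + p + k / a ^ k * (1 - p * (1 - a)) ^ m
        ≤ 3 / a / d + p + k / a ^ k / d := by linarith
      _ = (3 / a + k / a ^ k + Real.log d * (1 + η / 2)) / d := by
          rw [hpdef]
          ring
      _ ≤ (Real.log d * (1 + η)) / d := by
          refine div_le_div_of_nonneg_right ?_ hd0.le
          linarith
      _ = Real.log d / d * (1 + η) := by ring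
  have hrx : (G.rainbowIndex k : ℝ) + 1 ≤ D.card + k := by
    exact_mod_cast rainbowIndex_le_of_connected_dominating hk D hD hdom
  have := hcard.trans (mul_le_mul_of_nonneg_left htot (Nat.cast_nonneg _))
  rw [← mul_assoc] at this
  linarith

/-- A spanning tree with distinct colours bounds the `k`-rainbow index. -/
theorem Connected.rainbowIndex_le {V : Type*} [Fintype V] {G : SimpleGraph V}
    (hG : G.Connected) {k : ℕ} (hk : 0 < k) : G.rainbowIndex k + 1 ≤ Fintype.card V + k := by
  refine rainbowIndex_le_of_connected_dominating hk Finset.univ ?_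
    fun v hv => absurd (Finset.mem_univ v) hv
  rw [Finset.coe_univ]
  exact (induceUnivIso G).connected_iff.2 hG

/-- The conditions of `Connected.rainbowIndex_le_of_large_minDegree` hold for large `δ`. -/
theorem eventually_large_minDegree (k : ℕ) {η a : ℝ} (hη : 0 < η) (ha : 0 < a) :
    ∀ᶠ δ : ℕ in atTop, 1 ≤ a * ((δ : ℝ) + 1) ∧ 3 * (k : ℝ) ≤ (δ : ℝ) + 1 ∧
      Real.log ((δ : ℝ) + 1) * (1 + η / 2) ≤ (δ : ℝ) + 1 ∧
      3 / a + k / a ^ k ≤ Real.log ((δ : ℝ) + 1) * (η / 2) := by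
  have hd : Tendsto (fun δ : ℕ => (δ : ℝ) + 1) atTop atTop :=
    tendsto_atTop_add_const_right _ _ tendsto_natCast_atTop_atTop
  have hlog := Real.tendsto_log_atTop.comp hd
  have hlit := hd.eventually
    (Real.isLittleO_log_id_atTop.bound (c := (1 + η / 2)⁻¹) (by positivity))
  filter_upwards [(hd.const_mul_atTop ha).eventually_ge_atTop 1, hd.eventually_ge_atTop (3 * k),
    hlit, (hlog.atTop_mul_const (half_pos hη)).eventually_ge_atTop (3 / a + k / a ^ k)]
    with δ h₁ h₂ h₃ h₄
  refine ⟨h₁, h₂, ?_, h₄⟩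
  have h₅ := (le_abs_self _).trans h₃
  rw [id, Real.norm_of_nonneg (by positivity)] at h₅
  rw [inv_mul_eq_div, le_div_iff₀ (by positivity)] at h₅
  exact h₅

end SimpleGraph

/-! ### A single error function, and the conclusion -/

/-- Given an upward closed property `P δ e` that holds for some `e` for each `δ`, and for each
`e > 0` once `δ` is large, there is a witness `e = ε δ` tending to zero. -/
theorem exists_tendsto_zero_of_eventually {P : ℕ → ℝ → Prop}
    (hmono : ∀ δ e e', e ≤ e' → P δ e → P δ e') (hex : ∀ δ, ∃ e, P δ e)
    (hev : ∀ e > 0, ∀ᶠ δ in atTop, P δ e) :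
    ∃ ε : ℕ → ℝ, Tendsto ε atTop (𝓝 0) ∧ ∀ δ, P δ (ε δ) := by
  have h : ∀ δ, ∃ e, 0 ≤ e ∧ P δ e ∧ ∀ e' > 0, P δ e' → e < e' + 1 / ((δ : ℝ) + 1) := by
    intro δ
    let S : Set ℝ := {e | 0 < e ∧ P δ e}
    have hS : S.Nonempty := by
      obtain ⟨e, he⟩ := hex δ
      exact ⟨max e 1, lt_max_of_lt_right one_pos, hmono _ _ _ (le_max_left _ _) he⟩
    have hb : BddBelow S := ⟨0, fun e he => he.1.le⟩
    obtain ⟨e, he, hlt⟩ := exists_lt_of_csInf_lt hS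
      (lt_add_of_pos_right (sInf S) (Nat.one_div_pos_of_nat (α := ℝ) (n := δ)))
    exact ⟨e, he.1.le, he.2, fun e' h₀ h₁ =>
      hlt.trans_le (add_le_add_left (csInf_le hb ⟨h₀, h₁⟩) _)⟩
  choose ε h₀ h₁ h₂ using h
  refine ⟨ε, ?_, h₁⟩
  refine tendsto_order.2 ⟨fun b hb => Eventually.of_forall fun δ => hb.trans_le (h₀ δ),
    fun b hb => ?_⟩
  filter_upwards [hev (b / 2) (half_pos hb),
    (tendsto_one_div_add_atTop_nhds_zero_nat (𝕜 := ℝ)).eventually_lt_const (half_pos hb)]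
    with δ h₃ h₄
  linarith [h₂ δ (b / 2) (half_pos hb) h₃]

theorem mainTheorem4 :
    ∃ ε : ℕ → ℝ, Tendsto ε atTop (𝓝 0) ∧
      ∀ (δ : ℕ), 3 ≤ δ →
        ∀ (n : ℕ) (V : Type u) [Fintype V] (G : SimpleGraph V) [DecidableRel G.Adj],
          G.Connected → Fintype.card V = n → G.minDegree = δ →
            (G.rainbowIndex 3 : ℝ) ≤
              (n : ℝ) * (Real.log ((δ : ℝ) + 1) / ((δ : ℝ) + 1)) * (1 + ε δ) + 5 := by
  refine exists_tendsto_zero_of_eventually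
    (P := fun δ e => 3 ≤ δ →
      ∀ (n : ℕ) (V : Type u) [Fintype V] (G : SimpleGraph V) [DecidableRel G.Adj],
        G.Connected → Fintype.card V = n → G.minDegree = δ →
          (G.rainbowIndex 3 : ℝ) ≤
            (n : ℝ) * (Real.log ((δ : ℝ) + 1) / ((δ : ℝ) + 1)) * (1 + e) + 5) ?_ ?_ ?_
  · intro δ e e' hee h h3 n V _ G _ hG hn hδ
    have hlog : 0 ≤ Real.log ((δ : ℝ) + 1) :=
      Real.log_nonneg (by linarith [Nat.cast_nonneg (α := ℝ) δ])
    refine (h h3 n V G hG hn hδ).trans ?_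
    gcongr
  · intro δ
    -- This error turns the main term into `n`, so the spanning tree bound `n + 2` suffices.
    refine ⟨((δ : ℝ) + 1) / Real.log ((δ : ℝ) + 1) - 1, fun h3 n V _ G _ hG hn hδ => ?_⟩
    have h3' : (3 : ℝ) ≤ δ := by exact_mod_cast h3
    have hlog : 0 < Real.log ((δ : ℝ) + 1) := Real.log_pos (by linarith)
    have h := hG.rainbowIndex_le (k := 3) (by norm_num)
    have h' : (G.rainbowIndex 3 : ℝ) + 1 ≤ n + 3 := by
      rw [hn] at h
      exact_mod_cast h
    have : (n : ℝ) * (Real.log ((δ : ℝ) + 1) / ((δ : ℝ) + 1)) *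
        (1 + (((δ : ℝ) + 1) / Real.log ((δ : ℝ) + 1) - 1)) = n := by
      field_simp
      ring
    linarith
  · intro η hη
    have ha : 0 < η / (3 * (η + 2)) := by positivity
    filter_upwards [SimpleGraph.eventually_large_minDegree 3 hη ha] with δ h h3 n V _ G _ hG hn hδ
    obtain ⟨h₁, h₂, h₃, h₄⟩ := h
    have := hG.rainbowIndex_le_of_large_minDegree (k := 3) (by norm_num)
      (fun v => hδ ▸ G.minDegree_le_degree v) hη rfl rfl h₁ h₂ h₃ h₄
    rw [hn] at this
    push_cast at this
    linarith
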